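/- Let $S_0>0$, $\beta>0$ and $\rho\in\mathbb{R}$. Let $\mathcal{I}:\mathbb{R}\to[0,\infty]$ be the rate function of the discrete time average of the geometric Brownian motion, i.e. $$\mathcal{I}(x)=\inf\left\{\frac12\int_0^1\Big(g'(y)-\frac{\rho}{\sqrt{2\beta}}\Big)^2dy \;:\; g\in\mathcal{AC}_0[0,1],\ \int_0^1 e^{\sqrt{2\beta}\,g(y)}\,dy=\frac{x}{S_0}\right\}\qquad (x\ge 0),$$ and $\mathcal{I}(x)=\infty$ for $x<0$, where $\mathcal{AC}_0[0,1]$ is the set of absolutely continuous $g:[0,1]\to\mathbb{R}$ with $g(0)=0$, and $\inf\emptyset=\infty$. Then $\mathcal{I}(x)=\infty$ for $x\le 0$, and for every $x>0$ $$\mathcal{I}(x)=\frac{1}{2\beta}\,\mathcal{J}(x/S_0,\rho),\qquad \mathcal{J}(x/S_0,\rho)=\begin{cases}\mathcal{J}_1(x/S_0,\rho), & \frac{x}{S_0}\ge 1+\frac12\rho,\\[2pt] \mathcal{J}_2(x/S_0,\rho), & \frac{x}{S_0}\le 1+\frac12\rho,\end{cases}$$ where $\mathcal{J}_1,\mathcal{J}_2$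 are as follows (all expressions in $\delta$ and $\xi$ being extended by continuity to the points $\delta=0$, $\xi=0$ and $\cos\xi=0$). (1) If $x/S_0\ge 1+\frac12\rho$, the equation $$\frac1\delta\sinh\delta+\frac{2\rho}{\delta^2}\sinh^2\Big(\frac{\delta}{2}\Big)=\frac{x}{S_0}$$ has exactly one solution $\delta\ge 0$, and for every real solution $\delta$ of it $$\mathcal{J}_1\Big(\frac{x}{S_0},\rho\Big)=\frac12(\delta^2-\rho^2)\left(1-\frac{2\tanh(\frac12\delta)}{\delta+\rho\tanh(\frac12\delta)}\right)-2\rho\log\left[\cosh\Big(\frac{\delta}{2}\Big)+\frac{\rho}{\delta}\sinh\Big(\frac{\delta}{2}\Big)\right]+\rho^2 .$$ (2) If $x/S_0\le 1+\frac12\rho$, the equation $$\frac{1}{2\xi}\sin(2\xi)\left(1+\frac{\rho}{2}\,\frac{\tan\xi}{\xi}\right)=\frac{x}{S_0}$$ has exactly one solution $\xi\in[0,\pi)$, and for every solution $\xi\in(-\pi,\pi)$ of it $$\mathcal{J}_2\Big(\frac{x}{S_0},\rho\Big)=2\Big(\xi^2+\frac14\rho^2\Big)\left\{\frac{\tan\xi}{\xi+\frac{\rho}{2}\tan\xi}-1\right\}-2\rho\log\left(\cos\xi+\frac{\rho}{2\xi}\sin\xi\right)+\rho^2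 .$$ -/

import Mathlib

open scoped ENNReal

namespace AsianRate

noncomputable section

/-- The functions `g` in `AC₀[0,1]` (absolutely continuous on `[0,1]`, `g(0) = 0`) that satisfy
`∫₀¹ exp(√(2β) g(y)) dy = c`. Only the restriction of `g` to `[0,1]` matters. -/
def admissible (β c : ℝ) : Set (ℝ → ℝ) :=
  {g | AbsolutelyContinuousOnInterval g 0 1 ∧ g 0 = 0 ∧
    ∫ y in (0 : ℝ)..1, Real.exp (Real.sqrt (2 * β) * g y) = c}

/-- The action `½ ∫₀¹ (g'(y) - ρ / √(2β))² dy`, with value `∞` if the integral diverges. -/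
def action (β ρ : ℝ) (g : ℝ → ℝ) : ℝ≥0∞ :=
  ∫⁻ y in Set.Icc (0 : ℝ) 1,
    ENNReal.ofReal (1 / 2 * (deriv g y - ρ / Real.sqrt (2 * β)) ^ 2)

/-- The rate function: the infimum of the action over the admissible functions for `x ≥ 0`
(the infimum of the empty set being `∞`), and `∞` for `x < 0`. -/
def rateFunction (S₀ β ρ x : ℝ) : ℝ≥0∞ :=
  if 0 ≤ x then ⨅ g ∈ admissible β (x / S₀), action β ρ g else ⊤

/-- `sinh δ / δ + (2ρ / δ²) sinh²(δ/2)`, with its limit at the removable singularity `δ = 0`. -/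
def deltaLHS (ρ δ : ℝ) : ℝ :=
  if δ = 0 then 1 + ρ / 2
  else 1 / δ * Real.sinh δ + 2 * ρ / δ ^ 2 * Real.sinh (δ / 2) ^ 2

/-- The expression `𝓙₁` in `δ`, with its limit at the removable singularity `δ = 0`. -/
def J₁ (ρ δ : ℝ) : ℝ :=
  if δ = 0 then
    1 / 2 * (-ρ ^ 2) * (1 - 2 / (2 + ρ)) - 2 * ρ * Real.log (1 + ρ / 2) + ρ ^ 2
  else
    1 / 2 * (δ ^ 2 - ρ ^ 2) *
        (1 - 2 * Real.tanh (δ / 2) / (δ + ρ * Real.tanh (δ / 2)))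
      - 2 * ρ * Real.log (Real.cosh (δ / 2) + ρ / δ * Real.sinh (δ / 2)) + ρ ^ 2

/-- `(sin 2ξ / (2ξ)) (1 + (ρ/2) tan ξ / ξ)`, with its limits at the removable singularities
`ξ = 0` and `cos ξ = 0`. -/
def xiLHS (ρ ξ : ℝ) : ℝ :=
  if ξ = 0 then 1 + ρ / 2
  else if Real.cos ξ = 0 then ρ / (2 * ξ ^ 2)
  else 1 / (2 * ξ) * Real.sin (2 * ξ) * (1 + ρ / 2 * (Real.tan ξ / ξ))

/-- The expression `𝓙₂` in `ξ`, with its limits at the removable singularities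
`ξ = 0` and `cos ξ = 0`. -/
def J₂ (ρ ξ : ℝ) : ℝ :=
  if ξ = 0 then
    2 * (1 / 4 * ρ ^ 2) * (2 / (2 + ρ) - 1) - 2 * ρ * Real.log (1 + ρ / 2) + ρ ^ 2
  else if Real.cos ξ = 0 then
    2 * (ξ ^ 2 + 1 / 4 * ρ ^ 2) * (2 / ρ - 1)
      - 2 * ρ * Real.log (Real.cos ξ + ρ / (2 * ξ) * Real.sin ξ) + ρ ^ 2
  else
    2 * (ξ ^ 2 + 1 / 4 * ρ ^ 2) * (Real.tan ξ / (ξ + ρ / 2 * Real.tan ξ) - 1)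
      - 2 * ρ * Real.log (Real.cos ξ + ρ / (2 * ξ) * Real.sin ξ) + ρ ^ 2

/-! The values at the exceptional points are the continuous extensions. -/

lemma continuous_dslope_sinh : Continuous (dslope Real.sinh 0) := by
  rw [continuous_iff_continuousAt]
  intro x
  by_cases hx : x = 0
  · subst hx
    exact continuousAt_dslope_same.2 Real.differentiable_sinh.differentiableAt
  · exact (continuousAt_dslope_of_ne hx).2 Real.continuous_sinh.continuousAt

lemma dslope_sinh_zero : dslope Real.sinh 0 0 = 1 := by
  simp [dslope_same]

lemma dslope_sinh_of_ne {x : ℝ} (hx : x ≠ 0) : dslope Real.sinh 0 x = Real.sinh x / x := by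
  rw [dslope_of_ne _ hx, slope_def_field]; simp

theorem continuous_deltaLHS (ρ : ℝ) : Continuous (deltaLHS ρ) := by
  have h : deltaLHS ρ = fun δ => dslope Real.sinh 0 δ
      + ρ / 2 * dslope Real.sinh 0 (δ / 2) ^ 2 := by
    funext δ
    by_cases hδ : δ = 0
    · subst hδ; simp [deltaLHS]
    · rw [deltaLHS, if_neg hδ, dslope_sinh_of_ne hδ, dslope_sinh_of_ne (by simpa using hδ)]
      field_simp
  rw [h]
  have := continuous_dslope_sinh
  fun_prop

theorem continuous_xiLHS (ρ : ℝ) : Continuous (xiLHS ρ) := by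
  have h : xiLHS ρ = fun ξ => Real.sinc ξ * (Real.cos ξ + ρ / 2 * Real.sinc ξ) := by
    funext ξ
    by_cases hξ : ξ = 0
    · subst hξ; simp [xiLHS]
    · rw [xiLHS, if_neg hξ, Real.sinc_of_ne_zero hξ]
      split_ifs with hc
      · have hs : Real.sin ξ ^ 2 = 1 := by
          have := Real.sin_sq_add_cos_sq ξ
          rw [hc] at this; linarith
        rw [hc]; field_simp; linear_combination (-ρ) * hs
      · rw [Real.tan_eq_sin_div_cos, Real.sin_two_mul]; field_simp
  rw [h]
  have := Real.continuous_sinc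
  have := Real.continuous_cos
  fun_prop

theorem continuousAt_J₁_zero (ρ : ℝ) (hρ : 0 < 1 + ρ / 2) : ContinuousAt (J₁ ρ) 0 := by
  have h : J₁ ρ = fun δ => 1 / 2 * (δ ^ 2 - ρ ^ 2) *
        (1 - dslope Real.sinh 0 (δ / 2) /
          (Real.cosh (δ / 2) + ρ / 2 * dslope Real.sinh 0 (δ / 2)))
      - 2 * ρ * Real.log (Real.cosh (δ / 2) + ρ / 2 * dslope Real.sinh 0 (δ / 2))
      + ρ ^ 2 := by
    funext δ
    by_cases hδ : δ = 0
    · subst hδ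
      have h1 : (1 : ℝ) / (1 + ρ / 2) = 2 / (2 + ρ) := by
        have : 2 + ρ ≠ 0 := by linarith
        field_simp
      simp only [J₁, if_true, zero_div, dslope_sinh_zero, Real.cosh_zero, mul_one, h1]
      ring
    · have hδ2 : δ / 2 ≠ 0 := by simpa using hδ
      have hC := (Real.cosh_pos (δ / 2)).ne'
      rw [J₁, if_neg hδ, dslope_sinh_of_ne hδ2, Real.tanh_eq_sinh_div_cosh]
      set C := Real.cosh (δ / 2)
      set s := Real.sinh (δ / 2)
      have e1 : 2 * (s / C) = s / (δ / 2) * (δ / C) := by field_simp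
      have e2 : δ + ρ * (s / C) = (C + ρ / 2 * (s / (δ / 2))) * (δ / C) := by field_simp
      have e3 : ρ / δ * s = ρ / 2 * (s / (δ / 2)) := by field_simp
      rw [e1, e2, e3, mul_div_mul_right _ _ (div_ne_zero hδ hC)]
  rw [h]
  have := continuous_dslope_sinh
  have h0 : Real.cosh ((0 : ℝ) / 2) + ρ / 2 * dslope Real.sinh 0 (0 / 2) ≠ 0 := by
    simp only [zero_div, dslope_sinh_zero, Real.cosh_zero]; linarith
  have hc : Continuous fun δ : ℝ =>
      Real.cosh (δ / 2) + ρ / 2 * dslope Real.sinh 0 (δ / 2) := by fun_prop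
  exact (((by fun_prop : Continuous fun δ : ℝ => 1 / 2 * (δ ^ 2 - ρ ^ 2)).continuousAt.mul
    (continuousAt_const.sub ((by fun_prop : Continuous fun δ : ℝ =>
      dslope Real.sinh 0 (δ / 2)).continuousAt.div hc.continuousAt h0))).sub
    (continuousAt_const.mul (hc.continuousAt.log h0))).add continuousAt_const

theorem continuousAt_J₂ (ρ ξ₀ : ℝ) (h0 : Real.cos ξ₀ + ρ / 2 * Real.sinc ξ₀ ≠ 0) :
    ContinuousAt (J₂ ρ) ξ₀ := by
  have h : J₂ ρ = fun ξ => 2 * (ξ ^ 2 + 1 / 4 * ρ ^ 2) *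
        (Real.sinc ξ / (Real.cos ξ + ρ / 2 * Real.sinc ξ) - 1)
      - 2 * ρ * Real.log (Real.cos ξ + ρ / 2 * Real.sinc ξ) + ρ ^ 2 := by
    funext ξ
    by_cases hξ : ξ = 0
    · subst hξ
      have h1 : (1 : ℝ) / (1 + ρ / 2) = 2 / (2 + ρ) := by
        rw [show 1 + ρ / 2 = (2 + ρ) / 2 by ring, one_div_div]
      simp only [J₂, if_true, Real.sinc_zero, Real.cos_zero, mul_one, h1]
      ring
    · rw [J₂, if_neg hξ, Real.sinc_of_ne_zero hξ]
      have e3 : ρ / (2 * ξ) * Real.sin ξ = ρ / 2 * (Real.sin ξ / ξ) := by field_simp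
      split_ifs with hc
      · have hs : Real.sin ξ ≠ 0 := by
          intro hs
          have := Real.sin_sq_add_cos_sq ξ
          rw [hc, hs] at this; norm_num at this
        have e : Real.sin ξ / ξ / (0 + ρ / 2 * (Real.sin ξ / ξ)) = 2 / ρ := by
          by_cases hρ : ρ = 0
          · simp [hρ]
          · field_simp; simp
        rw [e3, hc, e]
      · rw [e3, Real.tan_eq_sin_div_cos]
        set C := Real.cos ξ
        set s := Real.sin ξ
        have e1 : s / C = s / ξ * (ξ / C) := by field_simp
        have e2 : ξ + ρ / 2 * (s / C) = (C + ρ / 2 * (s / ξ)) * (ξ / C) := by field_simp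
        rw [e2, e1, mul_div_mul_right _ _ (div_ne_zero hξ hc)]
  rw [h]
  have := Real.continuous_sinc
  have hc : Continuous fun ξ : ℝ => Real.cos ξ + ρ / 2 * Real.sinc ξ := by fun_prop
  exact (((by fun_prop : Continuous fun ξ : ℝ =>
      2 * (ξ ^ 2 + 1 / 4 * ρ ^ 2)).continuousAt.mul
    ((this.continuousAt.div hc.continuousAt h0).sub continuousAt_const)).sub
    (continuousAt_const.mul (hc.continuousAt.log h0))).add continuousAt_const

end

end AsianRate

namespace AsianRate

open MeasureTheory Set intervalIntegral

/-! With `f = √(2β) g` the problem is to minimize `½∫(f' - ρ)²` subject to `f(0) = 0` and `∫ exp f =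
c`, up to the factor `1/(2β)`. An extremal `w` satisfies `w'' = -λ exp w` and, since the right end
is free, `w'(1) = ρ`. The energy `w'²/2 + λ exp w = 2q` is conserved, and `G = exp(-w/2)` solves the
linear equation `G'' = q G`. Taking `q = κ²`, `δ = 2κ`, or `q = -ξ²` gives explicit extremals; the
constraint becomes the equation for `δ` or `ξ`, and the energy identity evaluates the action
(`rateFunction_eq_of_linear_ode`).

Global minimality is proved by calibration (`integral_le_of_calibration`): a pointwise lower bound
for the integrand whose excess over the extremal integrand has integral zero. For `λ ≤ 0` convexity
suffices. For `λ > 0` the Lagrangian is not convex, and the calibrating function `A` has to depend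
on the running integral of `exp f` (`integral_le_of_multiplier_pos`).

Uniqueness of the parameters: both equations read `s (C + (ρ/2) s) = c`, that is `C/s + ρ/2 = c/s²`,
whose sides are monotone in opposite directions. -/

/-! ### Global minimality of extremals -/

lemma absolutelyContinuousOnInterval_of_hasDerivAt {w v : ℝ → ℝ}
    (hw : ∀ y ∈ Icc (0 : ℝ) 1, HasDerivAt w (v y) y) (hv : ContinuousOn v (Icc 0 1)) :
    AbsolutelyContinuousOnInterval w 0 1 := by
  obtain ⟨K, hK⟩ := isCompact_Icc.exists_bound_of_continuousOn hv
  have hK0 : 0 ≤ K := (norm_nonneg _).trans (hK 0 (by simp))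
  apply LipschitzOnWith.absolutelyContinuousOnInterval (K := K.toNNReal)
  rw [uIcc_of_le zero_le_one]
  refine (convex_Icc (0 : ℝ) 1).lipschitzOnWith_of_nnnorm_hasDerivWithin_le
    (fun y hy => (hw y hy).hasDerivWithinAt) fun y hy => ?_
  rw [← NNReal.coe_le_coe, Real.coe_toNNReal K hK0]
  exact hK y hy

/-- A calibration inequality bounds the action of `f` from below by the action of `w`. -/
lemma integral_le_of_calibration {f w v A A' b : ℝ → ℝ} {ρ : ℝ}
    (hf : AbsolutelyContinuousOnInterval f 0 1)
    (hw : ∀ y ∈ Icc (0 : ℝ) 1, HasDerivAt w (v y) y) (hv : ContinuousOn v (Icc 0 1))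
    (hA : AbsolutelyContinuousOnInterval A 0 1)
    (hA' : ∀ y ∈ Ioo (0 : ℝ) 1, HasDerivAt A (A' y) y)
    (hb : ContinuousOn b (Icc 0 1)) (hb0 : ∫ y in (0 : ℝ)..1, b y = 0)
    (h0 : A 0 * (f 0 - w 0) = 0) (h1 : A 1 * (f 1 - w 1) = 0)
    (hle : ∀ y ∈ Ioo (0 : ℝ) 1, ∀ p : ℝ,
      1 / 2 * (v y - ρ) ^ 2 + A' y * (f y - w y) + A y * (p - v y) + b y ≤ 1 / 2 * (p - ρ) ^ 2)
    (hint : IntervalIntegrable (fun y => 1 / 2 * (deriv f y - ρ) ^ 2) volume 0 1) :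
    ∫ y in (0 : ℝ)..1, 1 / 2 * (v y - ρ) ^ 2 ≤ ∫ y in (0 : ℝ)..1, 1 / 2 * (deriv f y - ρ) ^ 2 := by
  have hu : uIcc (0 : ℝ) 1 = Icc 0 1 := uIcc_of_le zero_le_one
  have hwac := absolutelyContinuousOnInterval_of_hasDerivAt hw hv
  have hh := hf.fun_sub hwac
  have hparts := hA.integral_deriv_mul_eq_sub hh
  -- The `A` terms of the pointwise bound form the derivative of `A (f - w)`, which vanishes at both
  -- ends.
  rw [h0, h1, sub_zero] at hparts
  have hi2 : IntervalIntegrable (fun y => deriv A y * (f y - w y)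
      + A y * deriv (fun y => f y - w y) y) volume 0 1 :=
    (hA.intervalIntegrable_deriv.mul_continuousOn hh.continuousOn).add
      (hh.intervalIntegrable_deriv.continuousOn_mul hA.continuousOn)
  have hi1 : IntervalIntegrable (fun y => 1 / 2 * (v y - ρ) ^ 2) volume 0 1 :=
    ContinuousOn.intervalIntegrable (by rw [hu]; fun_prop)
  have hi3 : IntervalIntegrable b volume 0 1 := ContinuousOn.intervalIntegrable (by rwa [hu])
  have key : ∫ y in (0 : ℝ)..1, (1 / 2 * (v y - ρ) ^ 2 + (deriv A y * (f y - w y)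
      + A y * deriv (fun y => f y - w y) y) + b y) ≤
      ∫ y in (0 : ℝ)..1, 1 / 2 * (deriv f y - ρ) ^ 2 := by
    refine integral_mono_ae_restrict zero_le_one ((hi1.add hi2).add hi3) hint ?_
    rw [Filter.EventuallyLE, ae_restrict_iff' measurableSet_Icc]
    have hne : ∀ a : ℝ, ∀ᵐ y : ℝ, y ≠ a := fun a => by simp [ae_iff, measure_singleton]
    filter_upwards [hf.ae_differentiableAt, hne 0, hne 1] with y hd hy0 hy1 hy
    have hyo : y ∈ Ioo (0 : ℝ) 1 := ⟨lt_of_le_of_ne hy.1 hy0.symm, lt_of_le_of_ne hy.2 hy1⟩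
    rw [(hA' y hyo).deriv, ((hd (by rwa [hu])).hasDerivAt.fun_sub (hw y hy)).deriv]
    have := hle y hyo (deriv f y)
    linarith
  rw [integral_add (hi1.add hi2) hi3, integral_add hi1 hi2, hparts, hb0] at key
  linarith


/-- The action is minimized by an extremal whose multiplier makes the Lagrangian convex. -/
lemma integral_le_of_multiplier_nonpos {f w v : ℝ → ℝ} {ρ lam : ℝ}
    (hf : AbsolutelyContinuousOnInterval f 0 1)
    (hw : ∀ y ∈ Icc (0 : ℝ) 1, HasDerivAt w (v y) y)
    (hv : ∀ y ∈ Icc (0 : ℝ) 1, HasDerivAt v (-lam * Real.exp (w y)) y)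
    (h0 : f 0 = w 0) (h1 : v 1 = ρ)
    (hc : ∫ y in (0 : ℝ)..1, Real.exp (f y) = ∫ y in (0 : ℝ)..1, Real.exp (w y))
    (hlam : lam ≤ 0)
    (hint : IntervalIntegrable (fun y => 1 / 2 * (deriv f y - ρ) ^ 2) volume 0 1) :
    ∫ y in (0 : ℝ)..1, 1 / 2 * (v y - ρ) ^ 2 ≤ ∫ y in (0 : ℝ)..1, 1 / 2 * (deriv f y - ρ) ^ 2 := by
  have hu : uIcc (0 : ℝ) 1 = Icc 0 1 := uIcc_of_le zero_le_one
  have hwc : ContinuousOn w (Icc 0 1) := fun y hy => (hw y hy).continuousAt.continuousWithinAt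
  have hvc : ContinuousOn v (Icc 0 1) := fun y hy => (hv y hy).continuousAt.continuousWithinAt
  have hfc : ContinuousOn f (Icc 0 1) := hu ▸ hf.continuousOn
  have hef : IntervalIntegrable (fun y => Real.exp (f y)) volume 0 1 :=
    ContinuousOn.intervalIntegrable (by rw [hu]; fun_prop)
  have hew : IntervalIntegrable (fun y => Real.exp (w y)) volume 0 1 :=
    ContinuousOn.intervalIntegrable (by rw [hu]; fun_prop)
  refine integral_le_of_calibration (A := fun y => v y - ρ)
    (A' := fun y => -lam * Real.exp (w y))
    (b := fun y => lam * (Real.exp (f y) - Real.exp (w y))) hf hw hvc ?_ ?_ (by fun_prop) ?_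
    (by simp [h0]) (by simp [h1]) ?_ hint
  · exact absolutelyContinuousOnInterval_of_hasDerivAt
      (fun y hy => (hv y hy).sub_const ρ) (by fun_prop)
  · exact fun y hy => (hv y (Ioo_subset_Icc_self hy)).sub_const ρ
  · rw [intervalIntegral.integral_const_mul, integral_sub hef hew, hc, sub_self, mul_zero]
  · intro y _ p
    -- Tangent line of `exp` at `w y`; the quadratic part leaves the remainder `(p - v y)² / 2`.
    have h2 : Real.exp (w y) * (f y - w y + 1) ≤ Real.exp (f y) := by
      calc _ ≤ Real.exp (w y) * Real.exp (f y - w y) := by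
            gcongr; exact Real.add_one_le_exp _
        _ = Real.exp (f y) := by rw [← Real.exp_add]; congr 1; ring
    nlinarith [sq_nonneg (p - v y), mul_nonneg (neg_nonneg.2 hlam) (sub_nonneg.2 h2)]

/-- An antiderivative of `log (1 - x²)`, needed to exhibit the null term `b` of the nonconvex
calibration as an exact derivative. -/
lemma hasDerivAt_entropy {x : ℝ} (h1 : -1 < x) (h2 : x < 1) :
    HasDerivAt (fun x : ℝ => (1 + x) * Real.log (1 + x) - (1 - x) * Real.log (1 - x) - 2 * x)
      (Real.log (1 - x ^ 2)) x := by
  have e1 : 1 + x ≠ 0 := by linarith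
  have e2 : 1 - x ≠ 0 := by linarith
  have d1 : HasDerivAt (fun x : ℝ => 1 + x) 1 x := (hasDerivAt_id x).const_add 1
  have d2 : HasDerivAt (fun x : ℝ => 1 - x) (-1) x := (hasDerivAt_id x).const_sub 1
  refine (((d1.mul (d1.log e1)).sub (d2.mul (d2.log e2))).sub
    ((hasDerivAt_id x).const_mul 2)).congr_deriv ?_
  rw [show 1 - x ^ 2 = (1 + x) * (1 - x) by ring, Real.log_mul e1 e2]
  field_simp
  ring

/-- The pointwise inequality behind the calibration in the nonconvex case. -/
lemma mul_log_ratio_le {a r h m : ℝ} (ha : a = r * Real.exp h) (hr : 0 ≤ r) (hm : 0 < m) :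
    a * (1 + Real.log m) - r * m ≤ a * h := by
  -- For `r > 0` the left side is concave in `m` with maximum at `m = exp h`, where equality holds.
  have h1 := Real.add_one_le_exp (Real.log m - h)
  have h2 : Real.exp h * Real.exp (Real.log m - h) = m := by
    rw [← Real.exp_add, add_sub_cancel, Real.exp_log hm]
  have h3 : a * (Real.log m - h + 1) ≤ r * m := by
    nth_rw 2 [← h2]
    rw [← mul_assoc, ← ha]
    exact mul_le_mul_of_nonneg_left h1 (ha ▸ by positivity)
  linarith

/-- The action is minimized by an extremal with positive multiplier. -/
lemma integral_le_of_multiplier_pos {f w v : ℝ → ℝ} {ρ lam δ : ℝ}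
    (hf : AbsolutelyContinuousOnInterval f 0 1)
    (hw : ∀ y ∈ Icc (0 : ℝ) 1, HasDerivAt w (v y) y)
    (hv : ∀ y ∈ Icc (0 : ℝ) 1, HasDerivAt v (-lam * Real.exp (w y)) y)
    (h0 : f 0 = w 0) (h1 : v 1 = ρ)
    (hc : ∫ y in (0 : ℝ)..1, Real.exp (f y) = ∫ y in (0 : ℝ)..1, Real.exp (w y))
    (hlam : 0 < lam) (hδ : 0 < δ)
    (hE : ∀ y ∈ Icc (0 : ℝ) 1, v y ^ 2 / 2 + lam * Real.exp (w y) = δ ^ 2 / 2)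
    (hint : IntervalIntegrable (fun y => 1 / 2 * (deriv f y - ρ) ^ 2) volume 0 1) :
    ∫ y in (0 : ℝ)..1, 1 / 2 * (v y - ρ) ^ 2 ≤ ∫ y in (0 : ℝ)..1, 1 / 2 * (deriv f y - ρ) ^ 2 := by
  have hu : uIcc (0 : ℝ) 1 = Icc 0 1 := uIcc_of_le zero_le_one
  have hwc : ContinuousOn w (Icc 0 1) := fun y hy => (hw y hy).continuousAt.continuousWithinAt
  have hvc : ContinuousOn v (Icc 0 1) := fun y hy => (hv y hy).continuousAt.continuousWithinAt
  have hfc : ContinuousOn f (Icc 0 1) := hu ▸ hf.continuousOn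
  have hefc : ContinuousOn (fun y => Real.exp (f y)) (Icc 0 1) := by fun_prop
  have hef : IntervalIntegrable (fun y => Real.exp (f y)) volume 0 1 :=
    ContinuousOn.intervalIntegrable (by rwa [hu])
  set k := lam / δ with hk
  have hkpos : 0 < k := by positivity
  have hkδ : k * δ = lam := div_mul_cancel₀ _ hδ.ne'
  -- By the energy identity `z' = k exp w = (δ/2)(1 - z²)`. The function `φ` below is the analogue
  -- of `z` with `f` in place of `w`; the constraint forces `φ = z` at both ends.
  set z : ℝ → ℝ := fun y => -v y / δ with hz
  set F : ℝ → ℝ := fun y => ∫ t in (0 : ℝ)..y, Real.exp (f t) with hF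
  set φ : ℝ → ℝ := fun y => z 0 + k * F y with hφ
  have hvz : ∀ y, v y = -δ * z y := fun y => by simp only [hz]; field_simp
  have hz' : ∀ y ∈ Icc (0 : ℝ) 1, HasDerivAt z (k * Real.exp (w y)) y := fun y hy => by
    refine ((hv y hy).neg.div_const δ).congr_deriv ?_
    rw [hk]; ring
  have hzE : ∀ y ∈ Icc (0 : ℝ) 1, k * Real.exp (w y) = δ / 2 * (1 - z y ^ 2) := fun y hy => by
    have := hE y hy
    rw [hvz, ← hkδ] at this
    apply mul_left_cancel₀ hδ.ne'
    linarith
  have hzlt : ∀ y ∈ Icc (0 : ℝ) 1, z y ^ 2 < 1 := fun y hy => by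
    have h2 := hzE y hy
    have : 0 < k * Real.exp (w y) := by positivity
    rw [h2] at this
    have := pos_of_mul_pos_right this (by positivity)
    linarith
  have hFac : AbsolutelyContinuousOnInterval F 0 1 :=
    hef.absolutelyContinuousOnInterval_intervalIntegral (by simp)
  have hFc : ContinuousOn F (Icc 0 1) := hu ▸ hFac.continuousOn
  have hF' : ∀ y ∈ Ioo (0 : ℝ) 1, HasDerivAt F (Real.exp (f y)) y := fun y hy => by
    have hn : Icc (0 : ℝ) 1 ∈ nhds y := Icc_mem_nhds hy.1 hy.2
    refine integral_hasDerivAt_right (hef.mono_set ?_) ?_ (hefc.continuousAt hn)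
    · rw [uIcc_of_le hy.1.le, hu]; exact Icc_subset_Icc_right hy.2.le
    · exact (hefc.mono Ioo_subset_Icc_self).stronglyMeasurableAtFilter isOpen_Ioo y hy
  have hφ' : ∀ y ∈ Ioo (0 : ℝ) 1, HasDerivAt φ (k * Real.exp (f y)) y := fun y hy =>
    ((hF' y hy).const_mul k).const_add _
  have hφc : ContinuousOn φ (Icc 0 1) := by fun_prop
  have hzc : ContinuousOn z (Icc 0 1) := by fun_prop
  have hφ0 : φ 0 = z 0 := by simp [hφ, hF]
  have hφ1 : φ 1 = z 1 := by
    have hi : ∫ y in (0 : ℝ)..1, k * Real.exp (w y) = z 1 - z 0 :=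
      integral_eq_sub_of_hasDerivAt (fun y hy => hz' y (hu ▸ hy))
        (ContinuousOn.intervalIntegrable (by rw [hu]; fun_prop))
    rw [intervalIntegral.integral_const_mul, ← hc] at hi
    simp only [hφ, hF]; linarith
  -- Monotonicity keeps `φ` between `z 0` and `z 1`, hence inside `(-1, 1)`, where the logarithms
  -- below are regular.
  have hφmono : MonotoneOn φ (Icc 0 1) := by
    refine monotoneOn_of_deriv_nonneg (convex_Icc 0 1) hφc ?_ ?_
    · rw [interior_Icc]
      exact fun y hy => (hφ' y hy).differentiableAt.differentiableWithinAt
    · rw [interior_Icc]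
      exact fun y hy => by rw [(hφ' y hy).deriv]; positivity
  have hzb : ∀ y ∈ Icc (0 : ℝ) 1, -1 < z y ∧ z y < 1 := fun y hy =>
    abs_lt.1 ((sq_lt_one_iff_abs_lt_one _).1 (hzlt y hy))
  have hφb : ∀ y ∈ Icc (0 : ℝ) 1, -1 < φ y ∧ φ y < 1 := fun y hy =>
    ⟨(hzb 0 (by simp)).1.trans_le (hφ0 ▸ hφmono (by simp) hy hy.1),
      (hφ1 ▸ hφmono hy (by simp) hy.2 : φ y ≤ z 1).trans_lt (hzb 1 (by simp)).2⟩
  have hφlt : ∀ y ∈ Icc (0 : ℝ) 1, φ y ^ 2 < 1 := fun y hy =>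
    (sq_lt_one_iff_abs_lt_one _).2 (abs_lt.2 (hφb y hy))
  have hzne : ∀ y ∈ Icc (0 : ℝ) 1, 1 - z y ^ 2 ≠ 0 := fun y hy => by linarith [hzlt y hy]
  have hφne : ∀ y ∈ Icc (0 : ℝ) 1, 1 - φ y ^ 2 ≠ 0 := fun y hy => by linarith [hφlt y hy]
  have hlogz : ContinuousOn (fun y => Real.log (1 - z y ^ 2)) (Icc 0 1) :=
    ContinuousOn.log (by fun_prop) hzne
  have hlogφ : ContinuousOn (fun y => Real.log (1 - φ y ^ 2)) (Icc 0 1) :=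
    ContinuousOn.log (by fun_prop) hφne
  set L : ℝ → ℝ := fun x => (1 + x) * Real.log (1 + x) - (1 - x) * Real.log (1 - x) - 2 * x
  have hL : ∀ {u : ℝ → ℝ}, ContinuousOn u (Icc 0 1) →
      (∀ y ∈ Icc (0 : ℝ) 1, -1 < u y ∧ u y < 1) → ContinuousOn (fun y => L (u y)) (Icc 0 1) :=
    fun hu hub y hy => ContinuousAt.comp_continuousWithinAt
      (g := L) (hasDerivAt_entropy (hub y hy).1 (hub y hy).2).continuousAt (hu y hy)
  set b : ℝ → ℝ := fun y => δ * (k * Real.exp (f y) - k * Real.exp (w y)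
    + k * Real.exp (f y) * (Real.log (1 - φ y ^ 2) - Real.log (1 - z y ^ 2))
    + δ * z y * (φ y - z y)) with hb
  have hbc : ContinuousOn b (Icc 0 1) := by fun_prop
  have hbint : ∫ y in (0 : ℝ)..1, b y = 0 := by
    -- This antiderivative of `b` vanishes wherever `φ = z`, in particular at `0` and `1`.
    rw [integral_eq_sub_of_hasDerivAt_of_le zero_le_one (f := fun y => δ * (φ y - z y
      + L (φ y) - L (z y) - (φ y - z y) * Real.log (1 - z y ^ 2)))]
    · simp [hφ0, hφ1]
    · have := hL hφc hφb
      have := hL hzc hzb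
      fun_prop
    · intro y hy
      have hyc := Ioo_subset_Icc_self hy
      have dφ := hφ' y hy
      have dz := hz' y hyc
      have dL1 := (hasDerivAt_entropy (hφb y hyc).1 (hφb y hyc).2).comp y dφ
      have dL2 := (hasDerivAt_entropy (hzb y hyc).1 (hzb y hyc).2).comp y dz
      have dlog := ((dz.pow 2).const_sub 1).log (hzne y hyc)
      refine (((((dφ.sub dz).add dL1).sub dL2).sub
        ((dφ.sub dz).mul dlog)).const_mul δ).congr_deriv ?_
      have e : k * Real.exp (w y) / (1 - z y ^ 2) = δ / 2 := by
        rw [hzE y hyc, mul_div_assoc, div_self (hzne y hyc), mul_one]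
      have e2 : -(((2 : ℕ) : ℝ) * z y ^ (2 - 1) * (k * Real.exp (w y))) / (1 - z y ^ 2)
          = - (z y * δ) := by
        have : -(((2 : ℕ) : ℝ) * z y ^ (2 - 1) * (k * Real.exp (w y))) / (1 - z y ^ 2)
          = - 2 * z y * (k * Real.exp (w y) / (1 - z y ^ 2)) := by
          push_cast; ring
        rw [this, e]; ring
      simp only [Pi.sub_apply, Pi.pow_apply]
      rw [e2, hb]
      ring
    · exact ContinuousOn.intervalIntegrable (by rwa [hu])
  refine integral_le_of_calibration (A := fun y => -δ * φ y - ρ)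
    (A' := fun y => -δ * (k * Real.exp (f y))) (b := b) hf hw hvc ?_
    (fun y hy => ((hφ' y hy).const_mul (-δ)).sub_const ρ) hbc hbint (by simp [h0]) ?_ ?_ hint
  · have hcst : ∀ a : ℝ, AbsolutelyContinuousOnInterval (fun _ => a) 0 1 := fun a =>
      absolutelyContinuousOnInterval_of_hasDerivAt (v := fun _ => 0)
        (fun y _ => hasDerivAt_const y a) (by fun_prop)
    have e : (fun y => -δ * φ y - ρ) = fun y => -δ * k * F y - (δ * z 0 + ρ) := by
      funext y; simp only [hφ]; ring
    rw [e]
    exact (hFac.const_mul (-δ * k)).fun_sub (hcst (δ * z 0 + ρ))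
  · have : -δ * φ 1 - ρ = 0 := by rw [hφ1, ← hvz, h1, sub_self]
    simp only [this, zero_mul]
  · intro y hy p
    have hyc := Ioo_subset_Icc_self hy
    -- With this ratio as `m`, the product `r m` equals `(δ/2)(1 - φ²)`.
    have hm : 0 < (1 - φ y ^ 2) / (1 - z y ^ 2) :=
      div_pos (by linarith [hφlt y hyc]) (by linarith [hzlt y hyc])
    have key := mul_log_ratio_le (a := k * Real.exp (f y)) (r := k * Real.exp (w y))
      (h := f y - w y) (by rw [mul_assoc, ← Real.exp_add, add_sub_cancel]) (by positivity) hm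
    rw [Real.log_div (hφne y hyc) (hzne y hyc)] at key
    have e : k * Real.exp (w y) * ((1 - φ y ^ 2) / (1 - z y ^ 2)) = δ / 2 * (1 - φ y ^ 2) := by
      rw [hzE y hyc]; field_simp [hzne y hyc]
    rw [e] at key
    have key2 := mul_le_mul_of_nonneg_left key hδ.le
    -- The terms in `p` complete to this square minus `δ²(φ - z)²`, up to the factor `1/2`; `key2`
    -- supplies exactly the compensating amount.
    have hsq := sq_nonneg (p - v y + δ * (φ y - z y))
    simp only [hb, hzE y hyc]
    rw [hvz] at hsq ⊢
    linarith

/-! ### Scaling, and the rate function as the action of an extremal -/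

lemma action_eq {β : ℝ} (hβ : 0 < β) (ρ : ℝ) (g : ℝ → ℝ) :
    action β ρ g = ∫⁻ y in Icc (0 : ℝ) 1, ENNReal.ofReal (1 / (2 * β) *
      (1 / 2 * (deriv (fun y => Real.sqrt (2 * β) * g y) y - ρ) ^ 2)) := by
  have hs : Real.sqrt (2 * β) ^ 2 = 2 * β := Real.sq_sqrt (by positivity)
  have hs0 : Real.sqrt (2 * β) ≠ 0 := by positivity
  unfold action
  congr 1
  funext y
  congr 1
  rw [deriv_const_mul_field, show 1 / (2 * β) = 1 / Real.sqrt (2 * β) ^ 2 by rw [hs]]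
  field_simp

lemma action_eq_ofReal {β : ℝ} (hβ : 0 < β) (ρ : ℝ) (g : ℝ → ℝ)
    (hi : IntervalIntegrable
      (fun y => 1 / 2 * (deriv (fun y => Real.sqrt (2 * β) * g y) y - ρ) ^ 2) volume 0 1) :
    action β ρ g = ENNReal.ofReal (1 / (2 * β) * ∫ y in (0 : ℝ)..1,
      1 / 2 * (deriv (fun y => Real.sqrt (2 * β) * g y) y - ρ) ^ 2) := by
  rw [action_eq hβ, ← intervalIntegral.integral_const_mul, integral_of_le zero_le_one,
    ← integral_Icc_eq_integral_Ioc, ofReal_integral_eq_lintegral_ofReal]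
  · exact ((intervalIntegrable_iff_integrableOn_Icc_of_le zero_le_one).1 hi).const_mul _
  · exact Filter.Eventually.of_forall fun y => by positivity

lemma intervalIntegrable_of_action_ne_top {β : ℝ} (hβ : 0 < β) {ρ : ℝ} {g : ℝ → ℝ}
    (h : action β ρ g ≠ ⊤) :
    IntervalIntegrable
      (fun y => 1 / 2 * (deriv (fun y => Real.sqrt (2 * β) * g y) y - ρ) ^ 2) volume 0 1 := by
  rw [action_eq hβ, lintegral_ofReal_ne_top_iff_integrable] at h
  · rw [intervalIntegrable_iff_integrableOn_Icc_of_le zero_le_one]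
    have h2 := h.const_mul (2 * β)
    refine h2.congr (Filter.Eventually.of_forall fun y => ?_)
    simp only
    field_simp
  · exact (((((measurable_deriv _).sub_const ρ).pow_const 2).const_mul _).const_mul
      _).aestronglyMeasurable
  · exact Filter.Eventually.of_forall fun y => by positivity

/-- The rate function is the action of an extremal satisfying the transversality condition. -/
lemma rateFunction_eq_of_extremal {S₀ β ρ x lam q : ℝ} {w v : ℝ → ℝ} (hβ : 0 < β) (hx : 0 ≤ x)
    (hw : ∀ y ∈ Icc (0 : ℝ) 1, HasDerivAt w (v y) y)
    (hv : ∀ y ∈ Icc (0 : ℝ) 1, HasDerivAt v (-lam * Real.exp (w y)) y)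
    (h0 : w 0 = 0) (h1 : v 1 = ρ)
    (hc : ∫ y in (0 : ℝ)..1, Real.exp (w y) = x / S₀)
    (hE : ∀ y ∈ Icc (0 : ℝ) 1, v y ^ 2 / 2 + lam * Real.exp (w y) = 2 * q) :
    rateFunction S₀ β ρ x =
      ENNReal.ofReal (1 / (2 * β) * ∫ y in (0 : ℝ)..1, 1 / 2 * (v y - ρ) ^ 2) := by
  have hu : uIcc (0 : ℝ) 1 = Icc 0 1 := uIcc_of_le zero_le_one
  have hs0 : Real.sqrt (2 * β) ≠ 0 := by positivity
  have hvc : ContinuousOn v (Icc 0 1) := fun y hy => (hv y hy).continuousAt.continuousWithinAt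
  rw [rateFunction, if_pos hx]
  apply le_antisymm
  · have hw2 : (fun y => Real.sqrt (2 * β) * ((Real.sqrt (2 * β))⁻¹ * w y)) = w := by
      funext y; field_simp
    have hcongr : EqOn (fun y => 1 / 2 * (v y - ρ) ^ 2)
        (fun y => 1 / 2 * (deriv w y - ρ) ^ 2) (uIcc 0 1) := fun y hy => by
      simp only [(hw y (hu ▸ hy)).deriv]
    have hi : IntervalIntegrable (fun y => 1 / 2 * (v y - ρ) ^ 2) volume 0 1 :=
      ContinuousOn.intervalIntegrable (by rw [hu]; fun_prop)
    have hmem : (fun y => (Real.sqrt (2 * β))⁻¹ * w y) ∈ admissible β (x / S₀) := by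
      refine ⟨(absolutelyContinuousOnInterval_of_hasDerivAt hw hvc).const_mul _,
        by simp [h0], ?_⟩
      rw [← hc]
      congr 1
      funext y
      rw [congrFun hw2 y]
    refine (iInf₂_le _ hmem).trans_eq ?_
    rw [action_eq_ofReal hβ, hw2, integral_congr hcongr]
    rw [hw2]
    exact (intervalIntegrable_congr (hcongr.mono uIoc_subset_uIcc)).1 hi
  · refine le_iInf₂ fun g hg => ?_
    obtain ⟨hgac, hg0, hgc⟩ := hg
    by_cases htop : action β ρ g = ⊤
    · rw [htop]; exact le_top
    have hint := intervalIntegrable_of_action_ne_top hβ htop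
    rw [action_eq_ofReal hβ ρ g hint]
    gcongr ENNReal.ofReal (_ * ?_)
    have hf := hgac.const_mul (Real.sqrt (2 * β))
    have hf0 : Real.sqrt (2 * β) * g 0 = w 0 := by rw [hg0, h0, mul_zero]
    have hfc := hgc.trans hc.symm
    rcases le_or_gt lam 0 with hl | hl
    · exact integral_le_of_multiplier_nonpos hf hw hv hf0 h1 hfc hl hint
    -- A positive multiplier makes the energy `2q` positive, so `δ = 2√q` is available.
    · have hq : 0 < q := by
        have := hE 0 (by simp)
        have : 0 < lam * Real.exp (w 0) := by positivity
        nlinarith [sq_nonneg (v 0)]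
      refine integral_le_of_multiplier_pos (δ := 2 * Real.sqrt q) hf hw hv hf0 h1 hfc hl
        (by positivity) (fun y hy => ?_) hint
      rw [hE y hy, mul_pow, Real.sq_sqrt hq.le]
      ring

/-! ### Explicit extremals from the linear equation -/

/-- The value of the rate function in terms of a solution `s` of `s'' = q s`, `s(0) = 0`,
`s'(0) = 1` that is positive on `(0,1]`. -/
lemma rateFunction_eq_of_linear_ode {S₀ β ρ x q : ℝ} {C s : ℝ → ℝ} (hβ : 0 < β) (hx : 0 ≤ x)
    (hs : ∀ y, HasDerivAt s (C y) y) (hC : ∀ y, HasDerivAt C (q * s y) y)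
    (hs0 : s 0 = 0) (hsq : ∀ y, C y ^ 2 - q * s y ^ 2 = 1)
    (hsub : ∀ t, s 1 * C t - C 1 * s t = s (1 - t)) (hpos : ∀ y ∈ Ioc (0 : ℝ) 1, 0 < s y)
    (hD : 0 < C 1 + ρ / 2 * s 1) (hxc : s 1 * (C 1 + ρ / 2 * s 1) = x / S₀) :
    (rateFunction S₀ β ρ x : EReal) = ((1 / (2 * β) *
      (2 * q - 2 * (q - ρ ^ 2 / 4) * (s 1 / (C 1 + ρ / 2 * s 1))
        - 2 * ρ * Real.log (C 1 + ρ / 2 * s 1) + ρ ^ 2 / 2) : ℝ) : EReal) := by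
  have hu : uIcc (0 : ℝ) 1 = Icc 0 1 := uIcc_of_le zero_le_one
  set D := C 1 + ρ / 2 * s 1 with hDdef
  have hC0 : C 0 = 1 := by
    have h1 := hsub 0
    have h2 := hpos 1 (by simp)
    rw [hs0, sub_zero, mul_zero, sub_zero] at h1
    exact mul_left_cancel₀ h2.ne' (by rw [h1, mul_one])
  -- The solution of `G'' = q G` with `G 0 = 1` and `-2 G'(1)/G(1) = ρ`, the transversality
  -- condition; `H = -G'`.
  set G : ℝ → ℝ := fun y => (C (1 - y) + ρ / 2 * s (1 - y)) / D with hG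
  set H : ℝ → ℝ := fun y => (q * s (1 - y) + ρ / 2 * C (1 - y)) / D with hH
  have dsub : ∀ y : ℝ, HasDerivAt (fun y : ℝ => 1 - y) (-1) y := fun y =>
    (hasDerivAt_id y).const_sub 1
  have ds : ∀ y, HasDerivAt (fun y => s (1 - y)) (-C (1 - y)) y := fun y =>
    ((hs (1 - y)).comp y (dsub y)).congr_deriv (by ring)
  have dC : ∀ y, HasDerivAt (fun y => C (1 - y)) (-(q * s (1 - y))) y := fun y =>
    ((hC (1 - y)).comp y (dsub y)).congr_deriv (by ring)
  have dG : ∀ y, HasDerivAt G (-H y) y := fun y =>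
    (((dC y).add ((ds y).const_mul (ρ / 2))).div_const D).congr_deriv (by simp only [hH]; ring)
  have dH : ∀ y, HasDerivAt H (-(q * G y)) y := fun y =>
    ((((ds y).const_mul q).add ((dC y).const_mul (ρ / 2))).div_const D).congr_deriv
      (by simp only [hG]; ring)
  have hGpos : ∀ y ∈ Icc (0 : ℝ) 1, 0 < G y := by
    intro y hy
    have h1 := hsub (1 - y)
    rw [sub_sub_cancel] at h1
    -- Positivity of `G` follows from this combination of two nonnegative terms that are never both
    -- zero on `[0,1]`.
    have h2 : s 1 * (C (1 - y) + ρ / 2 * s (1 - y)) = s y + s (1 - y) * D := by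
      rw [hDdef]; linear_combination h1
    have hs1 := hpos 1 (by simp)
    refine div_pos (pos_of_mul_pos_right (a := s 1) ?_ hs1.le) hD
    rw [h2]
    rcases hy.1.eq_or_lt with h | h
    · rw [← h, sub_zero, hs0]; positivity
    · have h3 := hpos y ⟨h, hy.2⟩
      have h4 : 0 ≤ s (1 - y) := by
        rcases hy.2.eq_or_lt with h' | h'
        · rw [h', sub_self, hs0]
        · exact (hpos (1 - y) ⟨by linarith, by linarith⟩).le
      positivity
  have hquad : ∀ y, q * G y ^ 2 - H y ^ 2 = (q - ρ ^ 2 / 4) / D ^ 2 := fun y => by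
    simp only [hG, hH]
    rw [div_pow, div_pow, ← mul_div_assoc, ← sub_div]
    congr 1
    linear_combination (q - ρ ^ 2 / 4) * hsq (1 - y)
  have hG0 : G 0 = 1 := by simp only [hG, sub_zero]; exact div_self hD.ne'
  have hG1 : G 1 = 1 / D := by simp only [hG, sub_self, hC0, hs0]; ring
  have hH1 : H 1 = ρ / 2 / D := by simp only [hH, sub_self, hC0, hs0]; ring
  set lam := 2 * (q - ρ ^ 2 / 4) / D ^ 2 with hlam
  set w : ℝ → ℝ := fun y => -2 * Real.log (G y) with hwdef
  set v : ℝ → ℝ := fun y => 2 * H y / G y with hvdef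
  have hexp : ∀ y ∈ Icc (0 : ℝ) 1, Real.exp (w y) = 1 / G y ^ 2 := fun y hy => by
    have h1 : w y = Real.log ((G y ^ 2)⁻¹) := by
      rw [Real.log_inv, Real.log_pow]; simp only [hwdef]; push_cast; ring
    have := hGpos y hy
    rw [h1, Real.exp_log (by positivity), one_div]
  have hw : ∀ y ∈ Icc (0 : ℝ) 1, HasDerivAt w (v y) y := fun y hy =>
    (((dG y).log (hGpos y hy).ne').const_mul (-2)).congr_deriv (by simp only [hvdef]; ring)
  have hlam2 : ∀ y, lam = 2 * (q * G y ^ 2 - H y ^ 2) := fun y => by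
    rw [hquad, hlam]; ring
  have hv : ∀ y ∈ Icc (0 : ℝ) 1, HasDerivAt v (-lam * Real.exp (w y)) y := fun y hy => by
    have h0 := (hGpos y hy).ne'
    refine (((dH y).const_mul 2).div (dG y) h0).congr_deriv ?_
    rw [hexp y hy, hlam2 y]
    field_simp
    ring
  have hE : ∀ y ∈ Icc (0 : ℝ) 1, v y ^ 2 / 2 + lam * Real.exp (w y) = 2 * q := fun y hy => by
    have h0 := (hGpos y hy).ne'
    rw [hexp y hy, hlam2 y]
    simp only [hvdef]
    field_simp
    ring
  have h0 : w 0 = 0 := by simp [hwdef, hG0]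
  have hw1 : w 1 = 2 * Real.log D := by
    simp only [hwdef, hG1, one_div, Real.log_inv]; ring
  have h1 : v 1 = ρ := by
    simp only [hvdef, hG1, hH1]; field_simp
  have hwc : ContinuousOn w (Icc 0 1) := fun y hy => (hw y hy).continuousAt.continuousWithinAt
  have hvc : ContinuousOn v (Icc 0 1) := fun y hy => (hv y hy).continuousAt.continuousWithinAt
  have hei : IntervalIntegrable (fun y => Real.exp (w y)) volume 0 1 :=
    ContinuousOn.intervalIntegrable (by rw [hu]; fun_prop)
  have hvi : IntervalIntegrable v volume 0 1 :=
    ContinuousOn.intervalIntegrable (by rwa [hu])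
  have hc : ∫ y in (0 : ℝ)..1, Real.exp (w y) = s 1 * D := by
    -- Reduction of order: `s (1 - y)` is a second solution, so its quotient by `G` has derivative a
    -- constant Wronskian over `G²`.
    rw [integral_eq_sub_of_hasDerivAt (f := fun y => -D * (s (1 - y) / G y)) (fun y hy => ?_) hei]
    · simp [hs0, hG0]; ring
    · rw [hu] at hy
      have h0 := (hGpos y hy).ne'
      refine (((ds y).div (dG y) h0).const_mul (-D)).congr_deriv ?_
      have h2 : D * (C (1 - y) * G y - s (1 - y) * H y) = 1 := by
        simp only [hG, hH]
        field_simp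
        linear_combination 2 * hsq (1 - y)
      rw [hexp y hy, mul_div_assoc']
      congr 1
      linear_combination h2
  have hwint : ∫ y in (0 : ℝ)..1, v y = 2 * Real.log D := by
    rw [integral_eq_sub_of_hasDerivAt (fun y hy => hw y (hu ▸ hy)) hvi, hw1, h0, sub_zero]
  have hval : ∫ y in (0 : ℝ)..1, 1 / 2 * (v y - ρ) ^ 2 =
      2 * q - 2 * (q - ρ ^ 2 / 4) * (s 1 / D) - 2 * ρ * Real.log D + ρ ^ 2 / 2 := by
    -- Energy conservation trades `v²/2` for `exp w`, whose integral is known.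
    have hcongr : EqOn (fun y => 1 / 2 * (v y - ρ) ^ 2)
        (fun y => (2 * q + ρ ^ 2 / 2) - lam * Real.exp (w y) - ρ * v y) (uIcc 0 1) :=
      fun y hy => by
        have := hE y (hu ▸ hy)
        simp only
        linear_combination this
    rw [integral_congr hcongr, integral_sub _ (hvi.const_mul ρ),
      integral_sub _ (hei.const_mul lam), intervalIntegral.integral_const,
      intervalIntegral.integral_const_mul, intervalIntegral.integral_const_mul, hc, hwint, hlam]
    · simp only [smul_eq_mul]
      field_simp
      ring
    · exact intervalIntegrable_const
    · exact intervalIntegrable_const.sub (hei.const_mul lam)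
  rw [rateFunction_eq_of_extremal hβ hx hw hv h0 h1 (hc.trans hxc) hE, ← hval,
    EReal.coe_ennreal_ofReal, max_eq_left]
  exact mul_nonneg (by positivity) (integral_nonneg zero_le_one fun y _ => by positivity)

lemma rateFunction_of_nonpos {S₀ : ℝ} (hS₀ : 0 < S₀) (β ρ : ℝ) {x : ℝ} (hx : x ≤ 0) :
    rateFunction S₀ β ρ x = ⊤ := by
  rw [rateFunction]
  split_ifs with h
  · refine iInf₂_eq_top.2 fun g hg => absurd hg.2.2 (ne_of_gt ?_)
    have hc : ContinuousOn g (uIcc 0 1) := hg.1.continuousOn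
    have : 0 < ∫ y in (0 : ℝ)..1, Real.exp (Real.sqrt (2 * β) * g y) :=
      intervalIntegral_pos_of_pos (ContinuousOn.intervalIntegrable (by fun_prop))
        (fun y => Real.exp_pos _) zero_lt_one
    exact (div_nonpos_of_nonpos_of_nonneg hx hS₀.le).trans_lt this
  · rfl

/-! ### Hyperbolic and trigonometric parametrizations -/

lemma deltaLHS_eq (ρ κ : ℝ) : deltaLHS ρ (2 * κ) =
    dslope Real.sinh 0 κ * (Real.cosh κ + ρ / 2 * dslope Real.sinh 0 κ) := by
  by_cases h : κ = 0
  · subst h; simp [deltaLHS]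
  · rw [deltaLHS, if_neg (by simpa using h), dslope_sinh_of_ne h, Real.sinh_two_mul,
      mul_div_cancel_left₀ _ two_ne_zero]
    field_simp

lemma xiLHS_eq (ρ ξ : ℝ) :
    xiLHS ρ ξ = Real.sinc ξ * (Real.cos ξ + ρ / 2 * Real.sinc ξ) := by
  by_cases hξ : ξ = 0
  · subst hξ; simp [xiLHS]
  · rw [xiLHS, if_neg hξ, Real.sinc_of_ne_zero hξ]
    split_ifs with hc
    · have hs : Real.sin ξ ^ 2 = 1 := by
        have := Real.sin_sq_add_cos_sq ξ
        rw [hc] at this; linarith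
      rw [hc]; field_simp; linear_combination (-ρ) * hs
    · rw [Real.tan_eq_sin_div_cos, Real.sin_two_mul]; field_simp

lemma J₁_eq (ρ κ : ℝ) (hD : 0 < Real.cosh κ + ρ / 2 * dslope Real.sinh 0 κ) :
    J₁ ρ (2 * κ) = 2 * κ ^ 2 - 2 * (κ ^ 2 - ρ ^ 2 / 4) *
        (dslope Real.sinh 0 κ / (Real.cosh κ + ρ / 2 * dslope Real.sinh 0 κ))
      - 2 * ρ * Real.log (Real.cosh κ + ρ / 2 * dslope Real.sinh 0 κ) + ρ ^ 2 / 2 := by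
  by_cases h : κ = 0
  · subst h
    simp only [dslope_sinh_zero, Real.cosh_zero] at hD
    have h1 : (1 : ℝ) / (1 + ρ / 2) = 2 / (2 + ρ) := by
      have : 2 + ρ ≠ 0 := by linarith
      field_simp
    simp only [J₁, mul_zero, if_true, dslope_sinh_zero, Real.cosh_zero, mul_one, h1]
    ring
  · have hC := (Real.cosh_pos κ).ne'
    rw [dslope_sinh_of_ne h] at hD ⊢
    rw [J₁, if_neg (by simpa using h), mul_div_cancel_left₀ _ two_ne_zero,
      Real.tanh_eq_sinh_div_cosh]
    set C := Real.cosh κ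
    set s := Real.sinh κ
    have e1 : 2 * (s / C) = s / κ * (2 * κ / C) := by field_simp
    have e2 : 2 * κ + ρ * (s / C) = (C + ρ / 2 * (s / κ)) * (2 * κ / C) := by field_simp
    have e3 : ρ / (2 * κ) * s = ρ / 2 * (s / κ) := by field_simp
    rw [e1, e2, e3, mul_div_mul_right _ _ (div_ne_zero (by simpa using h) hC)]
    ring

lemma J₂_eq (ρ ξ : ℝ) :
    J₂ ρ ξ = 2 * (-ξ ^ 2) - 2 * (-ξ ^ 2 - ρ ^ 2 / 4) *
        (Real.sinc ξ / (Real.cos ξ + ρ / 2 * Real.sinc ξ))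
      - 2 * ρ * Real.log (Real.cos ξ + ρ / 2 * Real.sinc ξ) + ρ ^ 2 / 2 := by
  by_cases hξ : ξ = 0
  · subst hξ
    have h1 : (1 : ℝ) / (1 + ρ / 2) = 2 / (2 + ρ) := by
      rw [show 1 + ρ / 2 = (2 + ρ) / 2 by ring, one_div_div]
    simp only [J₂, if_true, Real.sinc_zero, Real.cos_zero, mul_one, h1]
    ring
  · rw [J₂, if_neg hξ, Real.sinc_of_ne_zero hξ]
    have e3 : ρ / (2 * ξ) * Real.sin ξ = ρ / 2 * (Real.sin ξ / ξ) := by field_simp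
    split_ifs with hc
    · have hs : Real.sin ξ ≠ 0 := by
        intro hs
        have := Real.sin_sq_add_cos_sq ξ
        rw [hc, hs] at this; norm_num at this
      have e : Real.sin ξ / ξ / (0 + ρ / 2 * (Real.sin ξ / ξ)) = 2 / ρ := by
        -- For `ρ = 0` both sides divide by zero and take the default value `0`.
        by_cases hρ : ρ = 0
        · simp [hρ]
        · field_simp; simp
      rw [e3, hc, e]
      ring
    · rw [e3, Real.tan_eq_sin_div_cos]
      set C := Real.cos ξ
      set s := Real.sin ξ
      have e1 : s / C = s / ξ * (ξ / C) := by field_simp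
      have e2 : ξ + ρ / 2 * (s / C) = (C + ρ / 2 * (s / ξ)) * (ξ / C) := by field_simp
      rw [e2, e1, mul_div_mul_right _ _ (div_ne_zero hξ hc)]
      ring

lemma dslope_sinh_pos (κ : ℝ) : 0 < dslope Real.sinh 0 κ := by
  rcases lt_trichotomy κ 0 with h | h | h
  · rw [dslope_sinh_of_ne h.ne]; exact div_pos_of_neg_of_neg (Real.sinh_neg_iff.2 h) h
  · rw [h, dslope_sinh_zero]; exact one_pos
  · rw [dslope_sinh_of_ne h.ne']; exact div_pos (Real.sinh_pos_iff.2 h) h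

lemma sinc_pos {ξ : ℝ} (hξ : |ξ| < Real.pi) : 0 < Real.sinc ξ := by
  obtain ⟨h1, h2⟩ := abs_lt.1 hξ
  rcases lt_trichotomy ξ 0 with h | h | h
  · rw [Real.sinc_of_ne_zero h.ne]
    exact div_pos_of_neg_of_neg (Real.sin_neg_of_neg_of_neg_pi_lt h h1) h
  · rw [h, Real.sinc_zero]; exact one_pos
  · rw [Real.sinc_of_ne_zero h.ne']; exact div_pos (Real.sin_pos_of_pos_of_lt_pi h h2) h

/-- Here `q = κ²`, `s y = sinh(κ y)/κ`, `C y = cosh(κ y)`. The sign of `κ` is irrelevant, and `D >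
0` follows from the equation since `x / S₀ > 0`. -/
lemma rateFunction_eq_J₁ {S₀ β ρ x δ : ℝ} (hS₀ : 0 < S₀) (hβ : 0 < β) (hx : 0 < x)
    (hδ : deltaLHS ρ δ = x / S₀) :
    (rateFunction S₀ β ρ x : EReal) = ((1 / (2 * β) * J₁ ρ δ : ℝ) : EReal) := by
  obtain ⟨κ, rfl⟩ : ∃ κ, δ = 2 * κ := ⟨δ / 2, by ring⟩
  rw [deltaLHS_eq] at hδ
  have hD : 0 < Real.cosh κ + ρ / 2 * dslope Real.sinh 0 κ :=
    pos_of_mul_pos_right (hδ ▸ div_pos hx hS₀) (dslope_sinh_pos κ).le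
  rw [J₁_eq ρ κ hD]
  set s : ℝ → ℝ := fun y => y * dslope Real.sinh 0 (κ * y) with hs
  set C : ℝ → ℝ := fun y => Real.cosh (κ * y) with hC
  have hs1 : s 1 = dslope Real.sinh 0 κ := by simp [hs]
  have hC1 : C 1 = Real.cosh κ := by simp [hC]
  have hκs : ∀ y, κ * s y = Real.sinh (κ * y) := fun y => by
    simp only [hs]
    by_cases h : κ * y = 0
    · rw [← mul_assoc, h]; simp
    · rw [dslope_sinh_of_ne h]; field_simp [left_ne_zero_of_mul h, right_ne_zero_of_mul h]
  have hd : ∀ y : ℝ, HasDerivAt (fun y => κ * y) κ y := fun y => by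
    simpa using (hasDerivAt_id y).const_mul κ
  have hs0 : κ = 0 → ∀ y, s y = y := fun h y => by simp [hs, h]
  have hsκ : κ ≠ 0 → s = fun y => Real.sinh (κ * y) / κ := fun h => by
    funext y; rw [← hκs]; field_simp
  rw [← hs1, ← hC1] at hδ hD ⊢
  refine rateFunction_eq_of_linear_ode hβ hx.le (C := C) (s := s) (fun y => ?_) (fun y => ?_)
    (by simp [hs]) (fun y => ?_) (fun t => ?_) (fun y hy => ?_) hD hδ
  · by_cases h : κ = 0
    · rw [show s = id from funext (hs0 h)]
      simpa [hC, h] using hasDerivAt_id y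
    · rw [hsκ h]
      refine ((hd y).sinh.div_const κ).congr_deriv ?_
      simp only [hC]; field_simp
  · refine (hd y).cosh.congr_deriv ?_
    rw [← hκs]; ring
  · rw [← mul_pow, hκs]; exact Real.cosh_sq_sub_sinh_sq _
  · by_cases h : κ = 0
    · simp [hs0 h, hC, h]
    · apply mul_left_cancel₀ h
      rw [hκs, mul_sub κ 1 t, Real.sinh_sub, ← hκs, ← hκs]
      simp only [hC, mul_one]; ring
  · exact mul_pos hy.1 (dslope_sinh_pos _)

/-- Here `q = -ξ²`; the bound `|ξ| < π` is what makes `s y = sin(ξ y)/ξ` positive on `(0,1]`. -/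
lemma rateFunction_eq_J₂ {S₀ β ρ x ξ : ℝ} (hS₀ : 0 < S₀) (hβ : 0 < β) (hx : 0 < x)
    (hπ : |ξ| < Real.pi) (hξ : xiLHS ρ ξ = x / S₀) :
    (rateFunction S₀ β ρ x : EReal) = ((1 / (2 * β) * J₂ ρ ξ : ℝ) : EReal) := by
  rw [xiLHS_eq] at hξ
  have hD : 0 < Real.cos ξ + ρ / 2 * Real.sinc ξ :=
    pos_of_mul_pos_right (hξ ▸ div_pos hx hS₀) (sinc_pos hπ).le
  rw [J₂_eq]
  set s : ℝ → ℝ := fun y => y * Real.sinc (ξ * y) with hs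
  set C : ℝ → ℝ := fun y => Real.cos (ξ * y) with hC
  have hs1 : s 1 = Real.sinc ξ := by simp [hs]
  have hC1 : C 1 = Real.cos ξ := by simp [hC]
  have hξs : ∀ y, ξ * s y = Real.sin (ξ * y) := fun y => by
    simp only [hs]
    by_cases h : ξ * y = 0
    · rw [← mul_assoc, h]; simp
    · rw [Real.sinc_of_ne_zero h]; field_simp [left_ne_zero_of_mul h, right_ne_zero_of_mul h]
  have hd : ∀ y : ℝ, HasDerivAt (fun y => ξ * y) ξ y := fun y => by
    simpa using (hasDerivAt_id y).const_mul ξ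
  have hs0 : ξ = 0 → ∀ y, s y = y := fun h y => by simp [hs, h]
  have hsξ : ξ ≠ 0 → s = fun y => Real.sin (ξ * y) / ξ := fun h => by
    funext y; rw [← hξs]; field_simp
  rw [← hs1, ← hC1] at hξ hD ⊢
  refine rateFunction_eq_of_linear_ode hβ hx.le (C := C) (s := s) (fun y => ?_) (fun y => ?_)
    (by simp [hs]) (fun y => ?_) (fun t => ?_) (fun y hy => ?_) hD hξ
  · by_cases h : ξ = 0
    · rw [show s = id from funext (hs0 h)]
      simpa [hC, h] using hasDerivAt_id y
    · rw [hsξ h]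
      refine ((hd y).sin.div_const ξ).congr_deriv ?_
      simp only [hC]; field_simp
  · refine (hd y).cos.congr_deriv ?_
    rw [← hξs]; ring
  · have := Real.cos_sq_add_sin_sq (ξ * y)
    rw [← hξs] at this
    simp only [hC]
    linear_combination this
  · by_cases h : ξ = 0
    · simp [hs0 h, hC, h]
    · apply mul_left_cancel₀ h
      rw [hξs, mul_sub ξ 1 t, Real.sin_sub, ← hξs, ← hξs]
      simp only [hC, mul_one]; ring
  · refine mul_pos hy.1 (sinc_pos ?_)
    rw [abs_mul, abs_of_pos hy.1]
    exact (mul_le_of_le_one_right (abs_nonneg ξ) hy.2).trans_lt hπ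

/-! ### Existence and uniqueness of the parameters -/

/-- A strictly monotone cotangent-type function and a monotone sine-type function allow at most
one solution of `s (C + r s) = c`. -/
lemma lt_absurd_of_quadratic {C₁ C₂ s₁ s₂ r c : ℝ} (hc : 0 ≤ c) (h₁ : 0 < s₁) (h₂ : 0 < s₂)
    (hs : s₁ ≤ s₂) (hC : C₁ / s₁ < C₂ / s₂)
    (e₁ : s₁ * (C₁ + r * s₁) = c) (e₂ : s₂ * (C₂ + r * s₂) = c) : False := by
  have a₁ : C₁ / s₁ + r = c / s₁ ^ 2 := by rw [← e₁]; field_simp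
  have a₂ : C₂ / s₂ + r = c / s₂ ^ 2 := by rw [← e₂]; field_simp
  have : c / s₂ ^ 2 ≤ c / s₁ ^ 2 := by gcongr
  linarith

lemma dslope_eventuallyEq {f : ℝ → ℝ} (hf : f 0 = 0) {x : ℝ} (hx : 0 < x) :
    dslope f 0 =ᶠ[nhds x] fun y => f y / y := by
  filter_upwards [lt_mem_nhds hx] with y hy
  rw [dslope_of_ne _ (ne_of_gt hy), slope_def_field, hf, sub_zero, sub_zero]

lemma hasDerivAt_dslope_zero {f : ℝ → ℝ} {f' x : ℝ} (hf : f 0 = 0) (hx : 0 < x)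
    (h : HasDerivAt f f' x) : HasDerivAt (dslope f 0) ((f' * x - f x) / x ^ 2) x :=
  ((h.div (hasDerivAt_id x) hx.ne').congr_deriv (by simp)).congr_of_eventuallyEq
    (dslope_eventuallyEq hf hx)

lemma hasDerivAt_div_dslope_zero {f g : ℝ → ℝ} {f' g' x : ℝ} (hf : f 0 = 0) (hx : 0 < x)
    (hfx : f x ≠ 0) (h : HasDerivAt f f' x) (hg : HasDerivAt g g' x) :
    HasDerivAt (fun y => g y / dslope f 0 y)
      (((g' * x + g x) * f x - g x * x * f') / f x ^ 2) x := by
  refine (((hg.mul (hasDerivAt_id x)).div h hfx).congr_deriv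
    (by simp)).congr_of_eventuallyEq ?_
  filter_upwards [dslope_eventuallyEq hf hx] with y hy
  rw [hy, div_div_eq_mul_div]
  rfl

lemma dslope_sinh_monotoneOn : MonotoneOn (dslope Real.sinh 0) (Ici 0) := by
  have hd : ∀ x : ℝ, 0 < x → HasDerivAt (dslope Real.sinh 0) _ x := fun x hx =>
    hasDerivAt_dslope_zero Real.sinh_zero hx (Real.hasDerivAt_sinh x)
  refine monotoneOn_of_deriv_nonneg (convex_Ici 0) continuous_dslope_sinh.continuousOn ?_ ?_
  · rw [interior_Ici]
    exact fun x hx => (hd x hx).differentiableAt.differentiableWithinAt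
  · rw [interior_Ici]
    intro x hx
    have hx0 : 0 < x := hx
    rw [(hd x hx).deriv]
    have h := (convex_Icc 0 x).image_sub_le_mul_sub_of_deriv_le (f := Real.sinh)
      (C := Real.cosh x) Real.continuous_sinh.continuousOn
      Real.differentiable_sinh.differentiableOn (fun y hy => by
        rw [interior_Icc] at hy
        rw [Real.deriv_sinh, Real.cosh_le_cosh, abs_of_pos hy.1, abs_of_pos hx0]
        exact hy.2.le) 0 (by simp [hx0.le]) x (by simp [hx0.le]) hx0.le
    rw [Real.sinh_zero, sub_zero, sub_zero] at h
    exact div_nonneg (sub_nonneg.2 h) (sq_nonneg x)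

/-- The derivative of `x cosh x / sinh x` has numerator `sinh x cosh x - x`, positive because `sinh
2x > 2x`. -/
lemma cosh_div_dslope_sinh_strictMonoOn :
    StrictMonoOn (fun κ => Real.cosh κ / dslope Real.sinh 0 κ) (Ici 0) := by
  refine strictMonoOn_of_deriv_pos (convex_Ici 0) (Real.continuous_cosh.div
    continuous_dslope_sinh fun κ => (dslope_sinh_pos κ).ne').continuousOn ?_
  rw [interior_Ici]
  intro x hx
  have hx0 : 0 < x := hx
  have hs := Real.sinh_pos_iff.2 hx0
  rw [(hasDerivAt_div_dslope_zero Real.sinh_zero hx0 hs.ne' (Real.hasDerivAt_sinh x)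
    (Real.hasDerivAt_cosh x)).deriv]
  refine div_pos ?_ (by positivity)
  have h1 := Real.self_lt_sinh_iff.2 (show 0 < 2 * x by positivity)
  rw [Real.sinh_two_mul] at h1
  have h2 := Real.cosh_sq_sub_sinh_sq x
  linear_combination h1 / 2 + x * h2

lemma sinc_antitoneOn : AntitoneOn Real.sinc (Icc 0 Real.pi) := by
  have hd : ∀ x : ℝ, 0 < x → HasDerivAt Real.sinc _ x := fun x hx => by
    rw [Real.sinc_eq_dslope]
    exact hasDerivAt_dslope_zero Real.sin_zero hx (Real.hasDerivAt_sin x)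
  refine antitoneOn_of_deriv_nonpos (convex_Icc 0 _) Real.continuous_sinc.continuousOn ?_ ?_
  · rw [interior_Icc]
    exact fun x hx => (hd x hx.1).differentiableAt.differentiableWithinAt
  · rw [interior_Icc]
    intro x hx
    rw [(hd x hx.1).deriv]
    refine div_nonpos_of_nonpos_of_nonneg (sub_nonpos.2 ?_) (sq_nonneg x)
    have hs := Real.sin_pos_of_pos_of_lt_pi hx.1 hx.2
    rcases le_or_gt (Real.cos x) 0 with hc | hc
    · exact (mul_nonpos_of_nonpos_of_nonneg hc hx.1.le).trans hs.le
    · have hx2 : x < Real.pi / 2 := by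
        by_contra! h
        exact hc.not_ge (Real.cos_nonpos_of_pi_div_two_le_of_le h (by linarith [hx.2]))
      have := Real.lt_tan hx.1 hx2
      rw [Real.tan_eq_sin_div_cos, lt_div_iff₀ hc] at this
      linarith

/-- The numerator of the derivative is `sin x cos x - x`, negative because `sin 2x < 2x`. -/
lemma cos_div_sinc_strictAntiOn :
    StrictAntiOn (fun ξ => Real.cos ξ / Real.sinc ξ) (Ico 0 Real.pi) := by
  refine strictAntiOn_of_deriv_neg (convex_Ico 0 _) (Real.continuous_cos.continuousOn.div
    Real.continuous_sinc.continuousOn fun ξ hξ =>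
      (sinc_pos (by rw [abs_of_nonneg hξ.1]; exact hξ.2)).ne') ?_
  rw [interior_Ico]
  intro x hx
  have hs := Real.sin_pos_of_pos_of_lt_pi hx.1 hx.2
  rw [Real.sinc_eq_dslope, (hasDerivAt_div_dslope_zero Real.sin_zero hx.1 hs.ne'
    (Real.hasDerivAt_sin x) (Real.hasDerivAt_cos x)).deriv]
  refine div_neg_of_neg_of_pos ?_ (by positivity)
  have h1 := Real.sin_lt (show 0 < 2 * x by linarith [hx.1])
  rw [Real.sin_two_mul] at h1
  have h2 := Real.sin_sq_add_cos_sq x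
  linear_combination h1 / 2 - x * h2

lemma existsUnique_deltaLHS {ρ c : ℝ} (hc : 0 < c) (hρ : 1 + ρ / 2 ≤ c) :
    ∃! δ : ℝ, 0 ≤ δ ∧ deltaLHS ρ δ = c := by
  have hone : ∀ κ : ℝ, 0 ≤ κ → 1 ≤ dslope Real.sinh 0 κ := fun κ hκ =>
    dslope_sinh_zero ▸ dslope_sinh_monotoneOn (mem_Ici.2 le_rfl) hκ hκ
  have hex : ∃ δ : ℝ, 0 ≤ δ ∧ deltaLHS ρ δ = c := by
    -- Large enough that `cosh κ ≥ sinh κ = κ s` absorbs `(ρ/2) s` and still leaves `c s`, where `s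
    -- = sinh κ / κ ≥ 1`.
    set κ := |ρ| / 2 + c with hκ
    have hκ0 : 0 < κ := by positivity
    have hlarge : c ≤ deltaLHS ρ (2 * κ) := by
      have h1 := hone κ hκ0.le
      have h2 : κ * dslope Real.sinh 0 κ ≤ Real.cosh κ := by
        rw [dslope_sinh_of_ne hκ0.ne', mul_div_cancel₀ _ hκ0.ne']
        exact (Real.sinh_lt_cosh κ).le
      have h3 : c * dslope Real.sinh 0 κ ≤ Real.cosh κ + ρ / 2 * dslope Real.sinh 0 κ := by
        have : 0 ≤ (|ρ| / 2 + ρ / 2) * dslope Real.sinh 0 κ :=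
          mul_nonneg (by linarith [neg_abs_le ρ]) (by linarith)
        rw [hκ] at h2 this ⊢
        linarith
      rw [deltaLHS_eq]
      calc c ≤ dslope Real.sinh 0 κ * (c * dslope Real.sinh 0 κ) := by
            nlinarith [mul_le_mul h1 h1 zero_le_one (zero_le_one.trans h1)]
        _ ≤ _ := mul_le_mul_of_nonneg_left h3 (zero_le_one.trans h1)
    obtain ⟨δ, hδ, h⟩ := intermediate_value_Icc (show (0 : ℝ) ≤ 2 * κ by positivity)
      (continuous_deltaLHS ρ).continuousOn ⟨by simpa [deltaLHS] using hρ, hlarge⟩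
    exact ⟨δ, hδ.1, h⟩
  have hlt : ∀ δ₁ δ₂ : ℝ, 0 ≤ δ₁ → δ₁ < δ₂ → deltaLHS ρ δ₁ = c → deltaLHS ρ δ₂ = c → False := by
    intro δ₁ δ₂ h0 h12 h1 h2
    rw [show δ₁ = 2 * (δ₁ / 2) by ring, deltaLHS_eq] at h1
    rw [show δ₂ = 2 * (δ₂ / 2) by ring, deltaLHS_eq] at h2
    have m1 : δ₁ / 2 ∈ Ici (0 : ℝ) := mem_Ici.2 (by linarith)
    have m2 : δ₂ / 2 ∈ Ici (0 : ℝ) := mem_Ici.2 (by linarith)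
    exact lt_absurd_of_quadratic hc.le (dslope_sinh_pos _) (dslope_sinh_pos _)
      (dslope_sinh_monotoneOn m1 m2 (by linarith))
      (cosh_div_dslope_sinh_strictMonoOn m1 m2 (by linarith)) h1 h2
  obtain ⟨δ, hδ, h⟩ := hex
  refine ⟨δ, ⟨hδ, h⟩, fun δ' h' => ?_⟩
  rcases lt_trichotomy δ' δ with hl | hl | hl
  · exact (hlt δ' δ h'.1 hl h'.2 h).elim
  · exact hl
  · exact (hlt δ δ' hδ hl h h'.2).elim

lemma existsUnique_xiLHS {ρ c : ℝ} (hc : 0 < c) (hρ : c ≤ 1 + ρ / 2) :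
    ∃! ξ : ℝ, 0 ≤ ξ ∧ ξ < Real.pi ∧ xiLHS ρ ξ = c := by
  have hπ : xiLHS ρ Real.pi = 0 := by
    rw [xiLHS_eq, Real.sinc_of_ne_zero Real.pi_ne_zero]; simp
  obtain ⟨ξ, hξ, h⟩ := intermediate_value_Icc' Real.pi_pos.le
    (continuous_xiLHS ρ).continuousOn
    (show c ∈ Icc (xiLHS ρ Real.pi) (xiLHS ρ 0) from
      ⟨by rw [hπ]; exact hc.le, by simpa [xiLHS] using hρ⟩)
  have hξπ : ξ < Real.pi := lt_of_le_of_ne hξ.2 fun e => by rw [e, hπ] at h; exact hc.ne h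
  have hlt : ∀ ξ₁ ξ₂ : ℝ, 0 ≤ ξ₁ → ξ₁ < ξ₂ → ξ₂ < Real.pi →
      xiLHS ρ ξ₁ = c → xiLHS ρ ξ₂ = c → False := by
    intro ξ₁ ξ₂ h0 h12 hp h1 h2
    rw [xiLHS_eq] at h1 h2
    have m1 : ξ₁ ∈ Ico 0 Real.pi := ⟨h0, h12.trans hp⟩
    have m2 : ξ₂ ∈ Ico 0 Real.pi := ⟨h0.trans h12.le, hp⟩
    exact lt_absurd_of_quadratic hc.le
      (sinc_pos (by rw [abs_of_nonneg m2.1]; exact m2.2))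
      (sinc_pos (by rw [abs_of_nonneg m1.1]; exact m1.2))
      (sinc_antitoneOn (Ico_subset_Icc_self m1) (Ico_subset_Icc_self m2) h12.le)
      -- Both monotonicities are reversed here, so the two points exchange roles.
      (cos_div_sinc_strictAntiOn m1 m2 h12) h2 h1
  refine ⟨ξ, ⟨hξ.1, hξπ, h⟩, fun ξ' h' => ?_⟩
  rcases lt_trichotomy ξ' ξ with hl | hl | hl
  · exact (hlt ξ' ξ h'.1 hl hξπ h'.2.2 h).elim
  · exact hl
  · exact (hlt ξ ξ' hξ.1 hl h'.2.1 h h'.2.2).elim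

end AsianRate

theorem mainTheorem5 (S₀ β ρ : ℝ) (hS₀ : 0 < S₀) (hβ : 0 < β) (x : ℝ) :
    (x ≤ 0 → AsianRate.rateFunction S₀ β ρ x = ⊤) ∧
    (0 < x → 1 + ρ / 2 ≤ x / S₀ →
      (∃! δ : ℝ, 0 ≤ δ ∧ AsianRate.deltaLHS ρ δ = x / S₀) ∧
      ∀ δ : ℝ, AsianRate.deltaLHS ρ δ = x / S₀ →
        (AsianRate.rateFunction S₀ β ρ x : EReal) =
          ((1 / (2 * β) * AsianRate.J₁ ρ δ : ℝ) : EReal)) ∧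
    (0 < x → x / S₀ ≤ 1 + ρ / 2 →
      (∃! ξ : ℝ, 0 ≤ ξ ∧ ξ < Real.pi ∧ AsianRate.xiLHS ρ ξ = x / S₀) ∧
      ∀ ξ : ℝ, |ξ| < Real.pi → AsianRate.xiLHS ρ ξ = x / S₀ →
        (AsianRate.rateFunction S₀ β ρ x : EReal) =
          ((1 / (2 * β) * AsianRate.J₂ ρ ξ : ℝ) : EReal)) := by
  refine ⟨AsianRate.rateFunction_of_nonpos hS₀ β ρ, fun hx hρ => ?_, fun hx hρ => ?_⟩
  · exact ⟨AsianRate.existsUnique_deltaLHS (div_pos hx hS₀) hρ,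
      fun δ hδ => AsianRate.rateFunction_eq_J₁ hS₀ hβ hx hδ⟩
  · exact ⟨AsianRate.existsUnique_xiLHS (div_pos hx hS₀) hρ,
      fun ξ hπ hξ => AsianRate.rateFunction_eq_J₂ hS₀ hβ hx hπ hξ⟩
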